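/- For a Dirichlet character $\chi$ let $L(s,\chi)$ denote its (analytically continued) $L$-function, and write $s=\sigma+it$. Call $\chi$ real if all its values are real, and complex otherwise. Let $f:\mathbb{Z}_{\ge 2}\to\mathbb{R}$ satisfy $2\le f(q)\ll\log q$; that is, for some constant $K$, $2\le f(q)\le K\log q$ for all $q\ge 2$. For $q\ge 2$ put $$\mathcal{Q}(q,f)=\Big\{s\in\mathbb{C} : \sigma>1-\frac{1}{f(q)},\ |t|<1-\frac{1}{\sqrt{f(q)\log q}}\Big\}.$$ Suppose that this family of regions is quasi zero-free, i.e. for every $q\ge 2$ and every primitive Dirichlet character $\chi \pmod q$: if $\chi$ is complex, then $L(s,\chi)$ has no zeros in $\mathcal{Q}(q,f)$; if $\chi$ is real, then $L(s,\chi)$ has at most one zero in $\mathcal{Q}(q,f)$, and such a zero is real, simple and greater than $\tfrac12$. Then there are constants $C$ and $q_0$, depending only on $K$ (and not otherwise on $f$), such that for all $q\ge\max(2,q_0)$: (1) for every complex primitive $\chi \pmod q$, $$\Big|\mathrm{Re}\,\frac{L'(1,\chi)}{L(1,\chi)}\Big|\le C\sqrt{f(q)\log q};$$ (2) for every real primitive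 $\chi \pmod q$ (equivalently, for every $\chi=\chi_D=(D\,|\,\cdot)$ with $D$ the discriminant of a quadratic number field and $|D|=q$), the maximum $\beta_D=\max\{\beta\in\mathbb{R} : L(\beta,\chi)=0\}$ exists and $$\Big|\frac{L'(1,\chi)}{L(1,\chi)}-\frac{1}{1-\beta_D}\Big|\le C\sqrt{f(q)\log q}.$$ -/

import Mathlib

/-- A Dirichlet character is real if all of its values are real numbers;
otherwise it is called complex. -/
def IsRealCharacter {q : ℕ} (χ : DirichletCharacter ℂ q) : Prop :=
  ∀ a : ZMod q, (χ a).im = 0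

/-- A family of regions `R q` (`q ≥ 2`) is quasi zero-free if, for every `q ≥ 2` and every
primitive Dirichlet character `χ` mod `q`: when `χ` is complex, `L(s, χ)` has no zero in `R q`;
when `χ` is real, `L(s, χ)` has at most one zero in `R q`, and such a zero is real, simple and
greater than `1 / 2`. -/
def IsQuasiZeroFree (R : ℕ → Set ℂ) : Prop :=
  ∀ (q : ℕ) [NeZero q], 2 ≤ q → ∀ χ : DirichletCharacter ℂ q, χ.IsPrimitive →
    (¬ IsRealCharacter χ → ∀ s ∈ R q, χ.LFunction s ≠ 0) ∧
    (IsRealCharacter χ →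
      {s ∈ R q | χ.LFunction s = 0}.Subsingleton ∧
      ∀ s ∈ R q, χ.LFunction s = 0 →
        s.im = 0 ∧ 1 / 2 < s.re ∧ analyticOrderAt χ.LFunction s = 1)

/-- The region `σ > 1 - 1 / f(q)`, `|t| < 1 - 1 / √(f(q) log q)`, where `s = σ + i t`. -/
noncomputable def boxRegion (f : ℕ → ℝ) (q : ℕ) : Set ℂ :=
  {s : ℂ | 1 - 1 / f q < s.re ∧ |s.im| < 1 - 1 / √(f q * Real.log q)}

/-! Put `ℓ = log q` and `X = √(f ℓ)`. At `1 + 1/X` one has `|L'/L| ≤ |ζ'/ζ| ≤ X + O(1)`, so it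
suffices to move from `1 + δ`, `δ = 1/X`, to `1`. Near `9/8`, `L` is the product of its nearby
linear factors and a zero-free `h`. As `L` grows by at most `exp (O(ℓ))`, Borel–Carathéodory makes
`h'/h` of size and Lipschitz constant `O(ℓ)`; its change is `O(ℓ/X) = O(X)`.

If every nearby zero has `Re ρ ≤ 1 - η`, `η = 1/f`, its term changes by at most `O(δ/η) Re (1 + δ -
ρ)⁻¹`. These real parts are positive with sum `O(X + ℓ)`, read off from `L'/L` and `h'/h` at `1 +
δ`. Since `δ/η = f/X` is bounded and `(f/X) ℓ = X`, the total is `O(X)` (`norm_logDeriv_one_le`,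
`norm_logDeriv_one_le_mul_sqrt`). An exceptional zero `β` is first divided out with `dslope`; its
term at `1` is exactly `1/(1 - β)`. -/

/-! ### Growth and zeros of entire functions near a point -/

open Complex Metric in
/-- If all points of `Z` are within `2 / 5` of `c`, the product of the distances to `Z` is larger
on the unit circle around `c` than at `c`, by a geometric factor. -/
theorem Multiset.norm_prod_sub_center_le {c : ℂ} (Z : Multiset ℂ)
    (hZ : ∀ ρ ∈ Z, ρ ∈ closedBall c (2 / 5)) {s : ℂ} (hs : s ∈ sphere c 1) :
    ‖(Z.map (c - ·)).prod‖ ≤ (2 / 3) ^ Z.card * ‖(Z.map (s - ·)).prod‖ := by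
  induction Z using Multiset.induction_on with
  | empty => simp
  | cons a Z ih =>
    have h1 := ih fun ρ hρ ↦ hZ ρ (Multiset.mem_cons_of_mem hρ)
    have h2 : ‖c - a‖ ≤ 2 / 5 := by
      have := hZ a (Multiset.mem_cons_self a Z)
      rwa [mem_closedBall, dist_comm, dist_eq_norm] at this
    have h3 : ‖s - c‖ = 1 := by rwa [mem_sphere, dist_eq_norm] at hs
    have h4 : ‖s - c‖ ≤ ‖s - a‖ + ‖c - a‖ := by
      calc ‖s - c‖ = ‖(s - a) - (c - a)‖ := by ring_nf
        _ ≤ _ := norm_sub_le _ _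
    simp only [Multiset.map_cons, Multiset.prod_cons, Multiset.card_cons, norm_mul, pow_succ]
    -- `‖s - a‖ ≥ 1 - 2/5 = 3/5`, and `2/5 = 2/3 * 3/5`.
    calc ‖c - a‖ * ‖(Z.map (c - ·)).prod‖
        ≤ (2 / 3 * ‖s - a‖) * ((2 / 3) ^ Z.card * ‖(Z.map (s - ·)).prod‖) := by
          gcongr
          linarith
      _ = _ := by ring

open Complex Metric in
/-- Dividing out zeros near the centre does not increase the growth of an entire function. -/
theorem Complex.norm_le_of_eq_prod_sub_mul {g h : ℂ → ℂ} {c : ℂ} {B : ℝ} (hB0 : 0 ≤ B)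
    (hh : Differentiable ℂ h) (hB : ∀ s ∈ sphere c 1, ‖g s‖ ≤ B * ‖g c‖) (Z : Multiset ℂ)
    (hZ : ∀ ρ ∈ Z, ρ ∈ closedBall c (2 / 5))
    (hgh : ∀ s, g s = (Z.map (s - ·)).prod * h s) {s : ℂ} (hs : s ∈ closedBall c 1) :
    ‖h s‖ ≤ (2 / 3) ^ Z.card * B * ‖h c‖ := by
  have key : ∀ w ∈ sphere c 1, ‖h w‖ ≤ (2 / 3) ^ Z.card * B * ‖h c‖ := by
    intro w hw
    have hpos : 0 < ‖(Z.map (w - ·)).prod‖ := by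
      rw [norm_pos_iff]
      refine Multiset.prod_ne_zero fun h0 ↦ ?_
      obtain ⟨ρ, hρ, h1⟩ := Multiset.mem_map.mp h0
      have h2 := hZ ρ hρ
      rw [← sub_eq_zero.mp h1, mem_closedBall, mem_sphere.mp hw] at h2
      norm_num at h2
    have h1 := hB w hw
    have h2 := Z.norm_prod_sub_center_le hZ hw
    rw [hgh w, hgh c, norm_mul, norm_mul] at h1
    refine le_of_mul_le_mul_left ?_ hpos
    calc _ ≤ B * (‖(Z.map (c - ·)).prod‖ * ‖h c‖) := h1
      _ ≤ B * (((2 / 3) ^ Z.card * ‖(Z.map (w - ·)).prod‖) * ‖h c‖) := by gcongr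
      _ = _ := by ring
  refine Complex.norm_le_of_forall_mem_frontier_norm_le (U := ball c 1) isBounded_ball
    hh.diffContOnCl ?_ ?_
  · rw [frontier_ball c one_ne_zero]; exact key
  · rwa [closure_ball c one_ne_zero]

open Complex Metric in
/-- An entire function of controlled growth factors into its zeros near the centre and an entire
function without zeros there. -/
theorem Complex.exists_eq_prod_sub_mul {g : ℂ → ℂ} {c : ℂ} {B : ℝ} (hB0 : 0 ≤ B)
    (hg : Differentiable ℂ g) (hgc : g c ≠ 0) (hB : ∀ s ∈ sphere c 1, ‖g s‖ ≤ B * ‖g c‖) :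
    ∃ (Z : Multiset ℂ) (h : ℂ → ℂ), (∀ ρ ∈ Z, ρ ∈ closedBall c (2 / 5)) ∧ Differentiable ℂ h ∧
      (∀ s, g s = (Z.map (s - ·)).prod * h s) ∧ ∀ s ∈ closedBall c (2 / 5), h s ≠ 0 := by
  -- Extract as many zeros as possible: the gain `(2/3)^card` bounds their number, and a zero left
  -- in `h` could still be split off.
  let S : Set ℕ := {n | ∃ (Z : Multiset ℂ) (h : ℂ → ℂ), Z.card = n ∧
    (∀ ρ ∈ Z, ρ ∈ closedBall c (2 / 5)) ∧ Differentiable ℂ h ∧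
      ∀ s, g s = (Z.map (s - ·)).prod * h s}
  have hS : BddAbove S := by
    obtain ⟨N, hN⟩ := pow_unbounded_of_one_lt B (by norm_num : (1 : ℝ) < 3 / 2)
    refine ⟨N, ?_⟩
    rintro _ ⟨Z, h, rfl, hZ, hh, hgh⟩
    have h1 := Complex.norm_le_of_eq_prod_sub_mul hB0 hh hB Z hZ hgh
      (mem_closedBall_self zero_le_one)
    have h2 : 0 < ‖h c‖ := norm_pos_iff.mpr fun h0 ↦ hgc (by rw [hgh, h0, mul_zero])
    have h3 : 1 ≤ (2 / 3 : ℝ) ^ Z.card * B :=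
      le_of_mul_le_mul_right (by rwa [one_mul]) h2
    have h4 : (3 / 2 : ℝ) ^ Z.card ≤ B := by
      calc (3 / 2 : ℝ) ^ Z.card ≤ (3 / 2) ^ Z.card * ((2 / 3 : ℝ) ^ Z.card * B) :=
            le_mul_of_one_le_right (by positivity) h3
        _ = B := by rw [← mul_assoc, ← mul_pow]; norm_num
    by_contra! hlt
    exact absurd (hN.trans_le (pow_le_pow_right₀ (by norm_num) hlt.le)) h4.not_gt
  have hne : S.Nonempty := ⟨0, 0, g, by simp [hg]⟩
  obtain ⟨Z, h, hZn, hZ, hh, hgh⟩ := Nat.sSup_mem hne hS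
  refine ⟨Z, h, hZ, hh, hgh, fun ρ hρ h0 ↦ ?_⟩
  have hmem : sSup S + 1 ∈ S := by
    refine ⟨ρ ::ₘ Z, dslope h ρ, by simp [hZn], ?_, ?_, fun s ↦ ?_⟩
    · intro σ hσ
      rcases Multiset.mem_cons.mp hσ with rfl | hσ
      exacts [hρ, hZ σ hσ]
    · exact differentiableOn_univ.mp
        ((differentiableOn_dslope Filter.univ_mem).mpr hh.differentiableOn)
    · have := sub_smul_dslope h ρ s
      rw [h0, sub_zero, smul_eq_mul] at this
      rw [hgh s, ← this, Multiset.map_cons, Multiset.prod_cons]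
      ring
  exact absurd (le_csSup hS hmem) (by simp)

/-! ### Logarithmic derivatives -/

open Complex Metric in
/-- A holomorphic function without zeros on a disc has a logarithm there, vanishing at the
centre when normalised; its size is controlled by the growth of the function. -/
theorem Complex.exists_hasDerivAt_logDeriv_norm_le {h : ℂ → ℂ} {c : ℂ} {R M : ℝ} (hR : 0 < R)
    (hM : 0 < M) (hh : Differentiable ℂ h) (h0 : ∀ s ∈ ball c R, h s ≠ 0)
    (hb : ∀ s ∈ ball c R, ‖h s‖ ≤ Real.exp M * ‖h c‖) :
    ∃ F : ℂ → ℂ, ∀ s ∈ ball c R, HasDerivAt F (logDeriv h s) s ∧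
      ‖F s‖ ≤ 2 * M * ‖s - c‖ / (R - ‖s - c‖) := by
  have hc := mem_ball_self (x := c) hR
  have hd : DifferentiableOn ℂ (logDeriv h) (ball c R) := fun s hs ↦
    ((hh.analyticAt s).deriv.differentiableAt.div (hh s) (h0 s hs)).differentiableWithinAt
  obtain ⟨F, hFc, hF⟩ := hd.isExactOn_ball.with_val_at c 0
  refine ⟨F, fun s hs ↦ ⟨hF s hs, ?_⟩⟩
  have hexp : ∀ w ∈ ball c R, h w = h c * exp (F w) := by
    intro w hw
    have hconst : ∀ z ∈ ball c R, HasDerivAt (fun z ↦ h z * exp (-F z)) 0 z := by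
      intro z hz
      have := (hh z).hasDerivAt.mul (hF z hz).neg.cexp
      refine this.congr_deriv ?_
      rw [logDeriv_apply]
      field_simp [h0 z hz]
      ring
    have := (convex_ball c R).is_const_of_fderivWithin_eq_zero (𝕜 := ℂ)
      (f := fun z ↦ h z * exp (-F z)) (fun z hz ↦ (hconst z hz).differentiableAt.differentiableWithinAt)
      (fun z hz ↦ by
        rw [fderivWithin_of_isOpen isOpen_ball hz]
        ext
        simpa using (hconst z hz).deriv) hw hc
    simp only [hFc, neg_zero, exp_zero, mul_one] at this
    rw [← this, mul_assoc, ← exp_add, neg_add_cancel, exp_zero, mul_one]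
  -- The growth bound is a one-sided bound on `Re F`, all that Borel–Carathéodory needs.
  have hre : ∀ w ∈ ball c R, (F w).re ≤ M := by
    intro w hw
    have h1 := hb w hw
    rw [hexp w hw, norm_mul, norm_exp, mul_comm] at h1
    exact Real.exp_le_exp.mp (le_of_mul_le_mul_right h1 (norm_pos_iff.mpr (h0 c hc)))
  have hshift : ∀ z ∈ ball (0 : ℂ) R, z + c ∈ ball c R := by
    intro z hz
    simpa [mem_ball, dist_eq_norm] using hz
  have hz : s - c ∈ ball (0 : ℂ) R := by
    simpa [mem_ball, dist_eq_norm] using hs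
  have := borelCaratheodory_zero (f := fun z ↦ F (z + c)) (R := R) (z := s - c) hM
    (fun z hz ↦ ((hF _ (hshift z hz)).comp_add_const z c).differentiableAt.differentiableWithinAt)
    (fun z hz ↦ hre _ (hshift z hz)) hR hz (by simpa using hFc)
  simpa using this

open Complex Metric in
/-- Bounds for the logarithmic derivative of a function without zeros in a disc. -/
theorem Complex.norm_logDeriv_le_and_lipschitz {h : ℂ → ℂ} {c : ℂ} {M : ℝ}
    (hM : 0 < M) (hh : Differentiable ℂ h) (h0 : ∀ s ∈ ball c (2 / 5), h s ≠ 0)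
    (hb : ∀ s ∈ ball c (2 / 5), ‖h s‖ ≤ Real.exp M * ‖h c‖) :
    (∀ s ∈ closedBall c (1 / 8), ‖logDeriv h s‖ ≤ 60 * M) ∧
    ∀ s ∈ closedBall c (1 / 8), ∀ w ∈ closedBall c (1 / 8),
      ‖logDeriv h s - logDeriv h w‖ ≤ 800 * M * ‖s - w‖ := by
  obtain ⟨F, hF⟩ := Complex.exists_hasDerivAt_logDeriv_norm_le (by norm_num) hM hh h0 hb
  -- The radii shrink `2/5 > 3/10 > 1/5 > 1/8`; Cauchy's estimate is used with radii `1/10` and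
  -- `3/40`, whence `60` and `800`.
  have hFb : ∀ s ∈ closedBall c (3 / 10), ‖F s‖ ≤ 6 * M := by
    intro s hs
    rw [mem_closedBall, dist_eq_norm] at hs
    refine (hF s (by rw [mem_ball, dist_eq_norm]; linarith)).2.trans ?_
    rw [div_le_iff₀ (by linarith)]
    nlinarith
  have hD : ∀ s ∈ closedBall c (1 / 5), ‖logDeriv h s‖ ≤ 60 * M := by
    intro s hs
    rw [mem_closedBall] at hs
    have hsub : ∀ w, dist w s ≤ 1 / 10 → dist w c ≤ 3 / 10 := fun w hw ↦ by
      linarith [dist_triangle w s c]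
    rw [← (hF s (by rw [mem_ball]; linarith)).1.deriv]
    refine (norm_deriv_le_of_forall_mem_sphere_norm_le (R := 1 / 10) (C := 6 * M) (by norm_num) ?_
      fun w hw ↦ hFb w (hsub w hw.le)).trans (by linarith)
    refine DifferentiableOn.diffContOnCl fun w hw ↦ ?_
    rw [closure_ball s (by norm_num)] at hw
    exact (hF w (by rw [mem_ball]; linarith [hsub w hw])).1.differentiableAt.differentiableWithinAt
  have hd : ∀ w ∈ ball c (2 / 5), DifferentiableAt ℂ (logDeriv h) w := fun s hs ↦
    (hh.analyticAt s).deriv.differentiableAt.div (hh s) (h0 s hs)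
  refine ⟨fun s hs ↦ hD s (closedBall_subset_closedBall (by norm_num) hs), fun s hs w hw ↦ ?_⟩
  refine (convex_closedBall c (1 / 8)).norm_image_sub_le_of_norm_deriv_le (𝕜 := ℂ)
    (fun z hz ↦ hd z (closedBall_subset_ball (by norm_num) hz)) (fun z hz ↦ ?_) hw hs
  rw [mem_closedBall] at hz
  have hsub : ∀ w, dist w z ≤ 3 / 40 → dist w c ≤ 1 / 5 := fun w hw ↦ by
    linarith [dist_triangle w z c]
  refine (norm_deriv_le_of_forall_mem_sphere_norm_le (R := 3 / 40) (C := 60 * M) (by norm_num) ?_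
      fun w hw ↦ hD w (hsub w hw.le)).trans (by linarith)
  refine DifferentiableOn.diffContOnCl fun w hw ↦ ?_
  rw [closure_ball z (by norm_num)] at hw
  exact (hd w (by rw [mem_ball]; linarith [hsub w hw])).differentiableWithinAt

/-- Logarithmic derivative of a product of linear factors and another function. -/
theorem logDeriv_prod_sub_mul {h : ℂ → ℂ} (hh : Differentiable ℂ h) (Z : Multiset ℂ) {s : ℂ}
    (hs : s ∉ Z) (h0 : h s ≠ 0) :
    logDeriv (fun s ↦ (Z.map (s - ·)).prod * h s) s
      = (Z.map fun ρ ↦ (s - ρ)⁻¹).sum + logDeriv h s := by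
  induction Z using Multiset.induction_on with
  | empty => simp
  | cons a Z ih =>
    obtain ⟨ha, hZ⟩ : s ≠ a ∧ s ∉ Z := by simpa using hs
    have hd : DifferentiableAt ℂ (fun s ↦ (Z.map (s - ·)).prod * h s) s := by
      refine DifferentiableAt.mul ?_ (hh s)
      have : (fun s : ℂ ↦ (Z.map (s - ·)).prod)
          = fun s ↦ (Z.map fun a ↦ Polynomial.X - Polynomial.C a).prod.eval s := by
        ext s
        simp [Polynomial.eval_multiset_prod]
      rw [this]
      exact Polynomial.differentiableAt _
    have hne : (Z.map (s - ·)).prod * h s ≠ 0 := by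
      refine mul_ne_zero (Multiset.prod_ne_zero fun h1 ↦ ?_) h0
      obtain ⟨ρ, hρ, h2⟩ := Multiset.mem_map.mp h1
      exact hZ (sub_eq_zero.mp h2 ▸ hρ)
    have := logDeriv_mul (f := fun z ↦ z - a) s (sub_ne_zero.mpr ha) hne (by fun_prop) hd
    simp only [Multiset.map_cons, Multiset.prod_cons, Multiset.sum_cons, mul_assoc]
    rw [this, ih hZ, add_assoc]
    congr 1
    simp [logDeriv_apply]

open Complex Metric in
/-- If the zeros of `g` near `9 / 8` have real part at most `1 - η`, the logarithmic derivative
of `g` at `1` is controlled by that at `1 + δ`. -/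
theorem Complex.norm_logDeriv_one_le {g : ℂ → ℂ} {M B η δ : ℝ} (hM : 0 < M)
    (hg : Differentiable ℂ g)
    (hgr : ∀ s ∈ sphere (9 / 8 : ℂ) 1, ‖g s‖ ≤ Real.exp M * ‖g (9 / 8)‖)
    (hη : 0 < η) (hδ : 0 < δ) (hδ' : δ ≤ 1 / 4)
    (hz : ∀ ρ ∈ closedBall (9 / 8 : ℂ) (2 / 5), g ρ = 0 → ρ.re ≤ 1 - η)
    (hB : ‖logDeriv g (1 + δ)‖ ≤ B) :
    ‖logDeriv g 1‖ ≤ B + 800 * M * δ + δ / η * (1 + δ / η) * (B + 60 * M) := by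
  have hgc : g (9 / 8) ≠ 0 := fun h0 ↦ by
    have := hz (9 / 8) (mem_closedBall_self (by norm_num)) h0
    norm_num at this
    linarith
  obtain ⟨Z, h, hZ, hh, hgh, h0⟩ := exists_eq_prod_sub_mul (Real.exp_pos M).le hg hgc hgr
  have hZre : ∀ ρ ∈ Z, ρ.re ≤ 1 - η := fun ρ hρ ↦ hz ρ (hZ ρ hρ) (by
    rw [hgh, Multiset.prod_eq_zero (Multiset.mem_map.mpr ⟨ρ, hρ, sub_self ρ⟩), zero_mul])
  have hhb : ∀ s ∈ ball (9 / 8 : ℂ) (2 / 5), ‖h s‖ ≤ Real.exp M * ‖h (9 / 8)‖ := fun s hs ↦ by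
    refine (norm_le_of_eq_prod_sub_mul (Real.exp_pos M).le hh hgr Z hZ hgh
      (ball_subset_closedBall (ball_subset_ball (by norm_num) hs))).trans ?_
    gcongr
    exact mul_le_of_le_one_left (Real.exp_pos M).le (pow_le_one₀ (by norm_num) (by norm_num))
  obtain ⟨hb1, hb2⟩ := norm_logDeriv_le_and_lipschitz hM hh
    (fun s hs ↦ h0 s (ball_subset_closedBall hs)) hhb
  -- The segment `[1, 5/4]` is a diameter of this disc.
  have hmem : ∀ x : ℝ, 0 ≤ x → x ≤ 1 / 4 → (1 + x : ℂ) ∈ closedBall (9 / 8 : ℂ) (1 / 8) := by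
    intro x hx hx'
    have : (1 + x - 9 / 8 : ℂ) = ((x - 1 / 8 : ℝ) : ℂ) := by push_cast; ring
    rw [mem_closedBall, dist_eq_norm, this, norm_real, Real.norm_eq_abs, abs_le]
    constructor <;> linarith
  have hlog : ∀ x : ℝ, 0 ≤ x → x ≤ 1 / 4 → logDeriv g (1 + x)
      = (Z.map fun ρ ↦ ((1 + x : ℂ) - ρ)⁻¹).sum + logDeriv h (1 + x) := by
    intro x hx hx'
    rw [funext hgh]
    refine logDeriv_prod_sub_mul hh Z (fun hxZ ↦ ?_)
      (h0 _ (closedBall_subset_closedBall (by norm_num) (hmem x hx hx')))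
    have := hZre _ hxZ
    simp at this
    linarith
  have h1 := hlog 0 le_rfl (by norm_num)
  have h2 := hlog δ hδ.le hδ'
  have hm1 := hmem 0 le_rfl (by norm_num)
  have hm2 := hmem δ hδ.le hδ'
  rw [ofReal_zero, add_zero] at h1 hm1
  -- Compare with `Re (1 + δ - ρ)⁻¹ ≥ η / ‖1 + δ - ρ‖ ^ 2`; the distances from `ρ` to `1 + δ` and to
  -- `1` have ratio at most `1 + δ / η`.
  have hterm : ∀ ρ ∈ Z, ‖(1 - ρ)⁻¹ - (1 + δ - ρ)⁻¹‖
      ≤ δ / η * (1 + δ / η) * ((1 + δ - ρ)⁻¹).re := by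
    intro ρ hρ
    have hρ1 := hZre ρ hρ
    have ha : η ≤ ‖1 - ρ‖ := by
      refine le_trans ?_ (re_le_norm _)
      simp; linarith
    have hre : η ≤ (1 + δ - ρ : ℂ).re := by simp; linarith
    have hb : 0 < ‖(1 + δ - ρ : ℂ)‖ := hη.trans_le (hre.trans (re_le_norm _))
    have hab : ‖(1 + δ - ρ : ℂ)‖ ≤ (1 + δ / η) * ‖1 - ρ‖ := by
      have : (1 + δ - ρ : ℂ) = (1 - ρ) + δ := by ring
      calc ‖(1 + δ - ρ : ℂ)‖ ≤ ‖1 - ρ‖ + δ := by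
            rw [this]
            refine (norm_add_le _ _).trans ?_
            rw [norm_real, Real.norm_of_nonneg hδ.le]
        _ ≤ ‖1 - ρ‖ + δ * (‖1 - ρ‖ / η) := by
            gcongr
            exact le_mul_of_one_le_right hδ.le ((one_le_div hη).mpr ha)
        _ = _ := by ring
    have ha0 : 0 < ‖1 - ρ‖ := hη.trans_le ha
    have e1 : (1 - ρ)⁻¹ - (1 + δ - ρ)⁻¹ = δ / ((1 - ρ) * (1 + δ - ρ)) := by
      have := norm_pos_iff.mp ha0
      have := norm_pos_iff.mp hb
      field_simp
      ring
    rw [e1, norm_div, norm_mul, norm_real, Real.norm_of_nonneg hδ.le, inv_re, normSq_eq_norm_sq]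
    calc δ / (‖1 - ρ‖ * ‖(1 + δ - ρ : ℂ)‖)
        = δ * ‖(1 + δ - ρ : ℂ)‖ / (‖1 - ρ‖ * ‖(1 + δ - ρ : ℂ)‖ ^ 2) := by
          field_simp
      _ ≤ δ * ((1 + δ / η) * ‖1 - ρ‖) / (‖1 - ρ‖ * ‖(1 + δ - ρ : ℂ)‖ ^ 2) := by gcongr
      _ = δ / η * (1 + δ / η) * (η / ‖(1 + δ - ρ : ℂ)‖ ^ 2) := by field_simp
      _ ≤ _ := by gcongr
  have hsum : ‖(Z.map fun ρ ↦ (1 - ρ)⁻¹).sum - (Z.map fun ρ ↦ (1 + δ - ρ : ℂ)⁻¹).sum‖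
      ≤ δ / η * (1 + δ / η) * ((Z.map fun ρ ↦ (1 + δ - ρ : ℂ)⁻¹).sum).re := by
    clear hgh hZ hZre h1 h2 hlog
    induction Z using Multiset.induction_on with
    | empty => simp
    | cons a Z ih =>
      have hi := ih fun ρ hρ ↦ hterm ρ (Multiset.mem_cons_of_mem hρ)
      have hia := hterm a (Multiset.mem_cons_self a Z)
      simp only [Multiset.map_cons, Multiset.sum_cons, add_re]
      rw [mul_add]
      refine le_trans (le_of_eq ?_) ((norm_add_le _ _).trans (add_le_add hia hi))
      congr 1
      ring
  -- The factorisation at `1 + δ` gives this sum, so no count of zeros enters.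
  have hre : ((Z.map fun ρ ↦ (1 + δ - ρ : ℂ)⁻¹).sum).re ≤ B + 60 * M := by
    refine (re_le_norm _).trans ?_
    rw [eq_sub_of_add_eq h2.symm]
    exact (norm_sub_le _ _).trans (add_le_add hB (hb1 _ hm2))
  have hL := hb2 _ hm1 _ hm2
  have hd : ‖(1 : ℂ) - (1 + δ)‖ = δ := by
    rw [sub_add_cancel_left, norm_neg, norm_real, Real.norm_of_nonneg hδ.le]
  rw [hd] at hL
  have e : logDeriv g 1 = logDeriv g (1 + δ) + (logDeriv h 1 - logDeriv h (1 + δ))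
      + ((Z.map fun ρ ↦ (1 - ρ)⁻¹).sum - (Z.map fun ρ ↦ (1 + δ - ρ : ℂ)⁻¹).sum) := by
    rw [h1, h2]; ring
  rw [e]
  refine (norm_add₃_le).trans (add_le_add (add_le_add hB hL) (hsum.trans ?_))
  gcongr

/-! ### Dirichlet `L`-functions in the right half plane -/

/-- The sum of a nontrivial Dirichlet character over consecutive integers is at most the modulus. -/
theorem DirichletCharacter.norm_sum_Icc_le {q : ℕ} [NeZero q] {χ : DirichletCharacter ℂ q}
    (hχ : χ ≠ 1) (n : ℕ) : ‖∑ k ∈ Finset.Icc 1 n, χ k‖ ≤ q := by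
  have hq : 1 < q := by
    have h1 : q ≠ 1 := by
      rintro rfl
      exact hχ (Subsingleton.elim _ _)
    have := NeZero.pos q
    omega
  have : Fact (1 < q) := ⟨hq⟩
  have h0 : χ ((0 : ℕ) : ZMod q) = 0 := by
    rw [Nat.cast_zero]
    exact χ.map_zero
  have hr : ∑ k ∈ Finset.Icc 1 n, χ k = ∑ k ∈ Finset.range (n + 1), χ k := by
    rw [Finset.sum_range_succ', h0, add_zero, Finset.range_eq_Ico,
      Finset.sum_Ico_add' (fun k : ℕ ↦ χ k) 0 n 1]
    rfl
  have hfull : ∀ m : ℕ, ∑ k ∈ Finset.range q, χ ((m + k : ℕ) : ZMod q) = 0 := by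
    intro m
    rw [← MulChar.sum_eq_zero_of_ne_one hχ, ← Equiv.sum_comp (Equiv.addLeft (m : ZMod q))]
    refine Finset.sum_bij' (fun k _ ↦ (k : ZMod q)) (fun a _ ↦ a.val) (by simp)
      (fun a _ ↦ by simp [ZMod.val_lt]) (fun k hk ↦ ?_) (by simp) (by simp)
    exact ZMod.val_cast_of_lt (Finset.mem_range.mp hk)
  have hper : Function.Periodic (fun m : ℕ ↦ ∑ k ∈ Finset.range m, χ k) q := by
    intro m
    simp only [Finset.sum_range_add, hfull, add_zero]
  rw [hr, ← hper.map_mod_nat (n + 1)]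
  refine (norm_sum_le _ _).trans ((Finset.sum_le_card_nsmul _ _ 1 fun k _ ↦ χ.norm_le_one _).trans ?_)
  have := (Nat.mod_lt (n + 1) (NeZero.pos q)).le
  simpa using mod_cast this

open Complex MeasureTheory Set Filter Topology in
/-- A nontrivial Dirichlet `L`-function in the right half plane, in terms of the partial sums of
the character. -/
theorem DirichletCharacter.LFunction_eq_mul_integral {q : ℕ} [NeZero q]
    {χ : DirichletCharacter ℂ q} (hχ : χ ≠ 1) {s : ℂ} (hs : 0 < s.re) :
    χ.LFunction s = s * ∫ t in Ioi (1 : ℝ), (∑ k ∈ Finset.Icc 1 ⌊t⌋₊, χ k) * (t : ℂ) ^ (-(s + 1)) := by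
  set S : ℝ → ℂ := fun t ↦ ∑ k ∈ Finset.Icc 1 ⌊t⌋₊, χ k with hS
  have hSb : ∀ t, ‖S t‖ ≤ q := fun t ↦ norm_sum_Icc_le hχ _
  have hSm : Measurable S := (measurable_from_nat (f := fun n ↦ ∑ k ∈ Finset.Icc 1 n, χ k)).comp
    Nat.measurable_floor
  have hS0 : ∀ t < 1, S t = 0 := fun t ht ↦ by simp [hS, Nat.floor_eq_zero.mpr ht]
  have hmel : ∀ w : ℂ, mellin S (-w) = ∫ t in Ioi (1 : ℝ), S t * (t : ℂ) ^ (-(w + 1)) := by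
    intro w
    rw [mellin, setIntegral_eq_of_subset_of_forall_sdiff_eq_zero measurableSet_Ioi
      (Ici_subset_Ioi.mpr zero_lt_one), integral_Ici_eq_integral_Ioi]
    · refine setIntegral_congr_fun measurableSet_Ioi fun t _ ↦ ?_
      simp only [smul_eq_mul]
      rw [mul_comm]
      ring_nf
    · rintro t ⟨-, ht⟩
      rw [hS0 t (not_le.mp ht), smul_zero]
  rw [← hmel]
  have hdiff : DifferentiableOn ℂ (fun w ↦ w * mellin S (-w)) {w | 0 < w.re} := by
    intro w hw
    have : DifferentiableAt ℂ (mellin S) (-w) := by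
      -- `S` is bounded, hence `a = 0`; it vanishes near `0`, so any `b < -w.re` would do.
      refine mellin_differentiableAt_of_isBigO_rpow (a := 0) (b := -w.re - 1) ?_ ?_
        (by simpa using hw) ?_ (by simp)
      · refine LocallyIntegrable.locallyIntegrableOn ?_ _
        refine (locallyIntegrable_const (q : ℝ)).mono hSm.aestronglyMeasurable ?_
        exact ae_of_all _ fun t ↦ by simpa using hSb t
      · simp only [neg_zero, Real.rpow_zero]
        exact Asymptotics.isBigO_of_le' (c := q) _ fun t ↦ by simpa using hSb t
      · refine Asymptotics.IsBigO.of_bound 1 ?_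
        filter_upwards [nhdsWithin_le_nhds (gt_mem_nhds zero_lt_one)] with t ht
        rw [hS0 t ht, norm_zero]
        positivity
    exact (differentiableAt_id.mul
      (this.comp w differentiableAt_id.neg)).differentiableWithinAt
  have ho : IsOpen {w : ℂ | 0 < w.re} := isOpen_lt continuous_const continuous_re
  have key := (differentiable_LFunction hχ).differentiableOn.analyticOnNhd ho
    |>.eqOn_of_preconnected_of_eventuallyEq (hdiff.analyticOnNhd ho)
    (convex_halfSpace_re_gt 0).isPreconnected (z₀ := 2) (by simp) ?_
  · exact key hs
  · have : {w : ℂ | 1 < w.re} ∈ 𝓝 (2 : ℂ) :=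
      (isOpen_lt continuous_const continuous_re).mem_nhds (by simp)
    filter_upwards [this] with w hw
    rw [hmel, LFunction_eq_LSeries χ hw,
      LSeries_eq_mul_integral _ le_rfl (zero_lt_one.trans hw) (χ.LSeriesSummable_of_one_lt_re hw)]
    simp only [Real.rpow_zero]
    exact Asymptotics.isBigO_of_le' (c := q) _ fun n ↦ by simpa using norm_sum_Icc_le hχ n

open Complex MeasureTheory Set in
/-- A bound for nontrivial Dirichlet `L`-functions in the right half plane. -/
theorem DirichletCharacter.norm_LFunction_le {q : ℕ} [NeZero q]
    {χ : DirichletCharacter ℂ q} (hχ : χ ≠ 1) {s : ℂ} (hs : 0 < s.re) :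
    ‖χ.LFunction s‖ ≤ ‖s‖ * (q / s.re) := by
  rw [LFunction_eq_mul_integral hχ hs, norm_mul]
  gcongr
  have hlt : -(s.re + 1) < -1 := by linarith
  have hint := (integrableOn_Ioi_rpow_of_lt hlt zero_lt_one).const_mul (q : ℝ)
  refine (norm_integral_le_of_norm_le hint ?_).trans ?_
  · refine (ae_restrict_mem measurableSet_Ioi).mono fun t ht ↦ ?_
    rw [norm_mul, norm_cpow_eq_rpow_re_of_pos (zero_lt_one.trans ht), neg_re, add_re, one_re]
    exact mul_le_mul_of_nonneg_right (norm_sum_Icc_le hχ _)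
      (Real.rpow_nonneg (zero_le_one.trans ht.le) _)
  · rw [integral_const_mul, integral_Ioi_rpow_of_lt hlt zero_lt_one, Real.one_rpow]
    apply le_of_eq
    rw [neg_add, neg_add_cancel_right, neg_div_neg_eq, mul_one_div]

/-! ### Comparison with `ζ` to the right of `1` -/

/-- Dirichlet `L`-functions are bounded below at a point of absolute convergence, uniformly in the
character. -/
theorem DirichletCharacter.exists_le_norm_LFunction {s : ℂ} (hs : 1 < s.re) :
    ∃ c : ℝ, 0 < c ∧ ∀ (q : ℕ) [NeZero q] (χ : DirichletCharacter ℂ q), c ≤ ‖χ.LFunction s‖ := by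
  have hsum : Summable fun n : ℕ ↦ ‖LSeries.term 1 s n‖ := (LSeriesSummable_one_iff.mpr hs).norm
  set A := ∑' n : ℕ, ‖LSeries.term 1 s n‖
  have hA : 0 ≤ A := tsum_nonneg fun _ ↦ norm_nonneg _
  refine ⟨1 / (A + 1), by positivity, fun q _ χ ↦ ?_⟩
  -- `1 / L` is the series of `χ μ`, dominated by `A` for every `χ`; the `+ 1` only keeps the
  -- denominator positive.
  have h1 := LSeries.mul_mu_eq_one χ hs
  set f : ℕ → ℂ := (fun n : ℕ ↦ χ n) * fun n ↦ ((ArithmeticFunction.moebius n : ℤ) : ℂ)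
  have h2 : ‖LSeries f s‖ ≤ A := by
    refine tsum_of_norm_bounded hsum.hasSum fun n ↦ LSeries.norm_term_le s ?_
    simp only [f, Pi.mul_apply, norm_mul, Pi.one_apply, norm_one]
    refine mul_le_one₀ (χ.norm_le_one _) (norm_nonneg _) ?_
    rw [Complex.norm_intCast]
    exact_mod_cast ArithmeticFunction.abs_moebius_le_one
  rw [LFunction_eq_LSeries χ hs, div_le_iff₀ (by positivity)]
  calc 1 = ‖LSeries (fun n : ℕ ↦ χ n) s‖ * ‖LSeries f s‖ := by rw [← norm_mul, h1, norm_one]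
    _ ≤ _ := by gcongr; linarith

open Complex ArithmeticFunction in
/-- The logarithmic derivative of a Dirichlet `L`-function is dominated by that of `ζ`. -/
theorem DirichletCharacter.norm_logDeriv_LFunction_le {q : ℕ} [NeZero q]
    (χ : DirichletCharacter ℂ q) {x : ℝ} (hx : 1 < x) :
    ‖logDeriv χ.LFunction x‖ ≤ ‖logDeriv riemannZeta x‖ := by
  have hx' : 1 < (x : ℂ).re := by simpa
  have h1 : logDeriv χ.LFunction x = -LSeries ((fun n : ℕ ↦ χ n) * fun n ↦ (vonMangoldt n : ℂ)) x := by
    rw [LSeries_twist_vonMangoldt_eq χ hx', logDeriv_apply, deriv_LFunction_eq_deriv_LSeries χ hx',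
      LFunction_eq_LSeries χ hx']
    ring
  have h2 : logDeriv riemannZeta x = -LSeries (fun n ↦ (vonMangoldt n : ℂ)) x := by
    rw [LSeries_vonMangoldt_eq_deriv_riemannZeta_div hx', logDeriv_apply]
    ring
  have hsum := LSeriesSummable_vonMangoldt hx'
  -- At real `x` all terms are nonnegative, so the `ζ` side equals its absolute sum.
  have h3 : (LSeries (fun n ↦ (vonMangoldt n : ℂ)) x).re
      = ∑' n, ‖LSeries.term (fun n ↦ (vonMangoldt n : ℂ)) x n‖ := by
    rw [LSeries, re_tsum hsum]
    refine tsum_congr fun n ↦ ?_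
    rcases eq_or_ne n 0 with rfl | hn
    · simp
    · rw [LSeries.norm_term_eq, if_neg hn, LSeries.term_of_ne_zero hn, ofReal_re, norm_real,
        Real.norm_of_nonneg vonMangoldt_nonneg,
        show ((n : ℂ) ^ (x : ℂ)) = (((n : ℝ) ^ x : ℝ) : ℂ) by
          rw [ofReal_cpow (Nat.cast_nonneg n)]; simp,
        ← ofReal_div, ofReal_re]
  rw [h1, h2, norm_neg, norm_neg]
  refine le_trans ?_ (h3.symm.le.trans (re_le_norm _))
  refine tsum_of_norm_bounded hsum.norm.hasSum fun n ↦ LSeries.norm_term_le _ ?_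
  rw [Pi.mul_apply, norm_mul]
  exact mul_le_of_le_one_left (norm_nonneg _) (χ.norm_le_one _)

open Complex DirichletCharacter in
/-- The logarithmic derivative of `ζ` near its pole. -/
theorem exists_norm_logDeriv_riemannZeta_le :
    ∃ A : ℝ, 0 ≤ A ∧ ∀ δ : ℝ, 0 < δ → δ ≤ 1 → ‖logDeriv riemannZeta (1 + δ)‖ ≤ 1 / δ + A := by
  -- `LFunctionTrivChar₁ 1` is `(s - 1) ζ(s)` with the pole filled in; its logarithmic derivative is
  -- bounded on the compact segment `[1, 2]`.
  have hmod : LFunctionTrivChar 1 = riemannZeta := LFunction_modOne_eq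
  have hcont := continuousOn_neg_logDeriv_LFunctionTrivChar₁ 1
  have hcomp : ContinuousOn (fun δ : ℝ ↦ -deriv (LFunctionTrivChar₁ 1) (1 + δ)
      / LFunctionTrivChar₁ 1 (1 + δ)) (Set.Icc 0 1) := by
    refine hcont.comp (f := fun δ : ℝ ↦ (1 + δ : ℂ)) (by fun_prop) fun δ hδ ↦ ?_
    rcases hδ.1.eq_or_lt with rfl | h
    · left; simp
    · right
      rw [hmod]
      exact riemannZeta_ne_zero_of_one_lt_re (by simpa)
  obtain ⟨A, hA⟩ := isCompact_Icc.exists_bound_of_continuousOn hcomp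
  refine ⟨A, (norm_nonneg _).trans (hA 0 (by simp)), fun δ h0 h1 ↦ ?_⟩
  have hne : (1 + δ : ℂ) ≠ 1 := by simpa using h0.ne'
  have hz : riemannZeta (1 + δ) ≠ 0 := riemannZeta_ne_zero_of_one_lt_re (by simpa)
  have hδ : (δ : ℂ) ≠ 0 := ofReal_ne_zero.mpr h0.ne'
  have h2 := hA δ ⟨h0.le, h1⟩
  rw [deriv_LFunctionTrivChar₁_apply_of_ne_one 1 hne, LFunctionTrivChar₁,
    Function.update_of_ne hne, hmod, add_sub_cancel_left] at h2
  have e : logDeriv riemannZeta (1 + δ) = -(1 / δ : ℂ)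
      - -(δ * deriv riemannZeta (1 + δ) + riemannZeta (1 + δ)) / (δ * riemannZeta (1 + δ)) := by
    rw [logDeriv_apply]
    field_simp
    ring
  rw [e]
  refine (norm_sub_le _ _).trans (add_le_add (le_of_eq ?_) h2)
  rw [norm_neg, norm_div, norm_one, norm_real, Real.norm_of_nonneg h0.le]

/-! ### The choice of scale -/

open Complex Metric in
/-- The bound `Complex.norm_logDeriv_one_le` at the scale `δ = 1 / √(f ℓ)`, `η = 1 / f`. -/
theorem Complex.norm_logDeriv_one_le_mul_sqrt {K M₁ A : ℝ} (hM₁ : 0 < M₁) (hA : 0 ≤ A) :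
    ∃ C : ℝ, ∀ (f ℓ : ℝ) (g : ℂ → ℂ), 2 ≤ f → f ≤ K * ℓ → 8 ≤ ℓ → Differentiable ℂ g →
      (∀ s ∈ sphere (9 / 8 : ℂ) 1, ‖g s‖ ≤ Real.exp (M₁ * ℓ) * ‖g (9 / 8)‖) →
      (∀ ρ ∈ closedBall (9 / 8 : ℂ) (2 / 5), g ρ = 0 → ρ.re ≤ 1 - 1 / f) →
      ‖logDeriv g (1 + (1 / √(f * ℓ) : ℝ))‖ ≤ 2 * √(f * ℓ) + A →
      ‖logDeriv g 1‖ ≤ C * √(f * ℓ) := by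
  refine ⟨2 + A + 800 * M₁ + (1 + (K + 1)) * ((K + 1) * (2 + A) + 60 * M₁),
    fun f ℓ g hf hfK hℓ hg hgr hz hB ↦ ?_⟩
  have hK : 0 < K := by
    by_contra! h
    nlinarith
  set X := √(f * ℓ) with hX
  have hXsq : X ^ 2 = f * ℓ := Real.sq_sqrt (by positivity)
  have hX4 : 4 ≤ X := Real.le_sqrt_of_sq_le (by nlinarith)
  have hX0 : 0 < X := by linarith
  have hfX : f ≤ (K + 1) * X := by
    refine le_of_sq_le_sq ?_ (by positivity)
    nlinarith [mul_nonneg hK.le (sq_nonneg X), sq_nonneg (K * X), sq_nonneg X]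
  have hℓX : ℓ ≤ X * X := by nlinarith
  have key := norm_logDeriv_one_le (η := 1 / f) (δ := 1 / X) (M := M₁ * ℓ) (by positivity) hg hgr
    (by positivity) (by positivity) (one_div_le_one_div_of_le (by norm_num) hX4) hz hB
  have hr : 1 / X / (1 / f) = f / X := by field_simp
  rw [hr] at key
  have hfX' : f / X ≤ K + 1 := (div_le_iff₀ hX0).mpr hfX
  -- The balance that dictates `δ = 1 / X`.
  have hfℓ : f / X * ℓ = X := by
    field_simp
    linarith
  have h1 : 2 * X + A ≤ (2 + A) * X := by nlinarith
  have h2 : 800 * (M₁ * ℓ) * (1 / X) ≤ 800 * M₁ * X := by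
    rw [mul_one_div, div_le_iff₀ hX0]
    nlinarith [mul_le_mul_of_nonneg_left hℓX hM₁.le]
  have h3 : f / X * (2 * X + A + 60 * (M₁ * ℓ)) ≤ ((K + 1) * (2 + A) + 60 * M₁) * X := by
    calc f / X * (2 * X + A + 60 * (M₁ * ℓ)) = f / X * (2 * X + A) + 60 * M₁ * (f / X * ℓ) := by ring
      _ ≤ (K + 1) * ((2 + A) * X) + 60 * M₁ * X := by rw [hfℓ]; gcongr
      _ = _ := by ring
  calc ‖logDeriv g 1‖ ≤ (2 * X + A) + 800 * (M₁ * ℓ) * (1 / X)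
        + (1 + f / X) * (f / X * (2 * X + A + 60 * (M₁ * ℓ))) := key.trans_eq (by ring)
    _ ≤ (2 + A) * X + 800 * M₁ * X
        + (1 + (K + 1)) * (((K + 1) * (2 + A) + 60 * M₁) * X) := by gcongr
    _ = _ := by ring

theorem le_mul_sqrt_mul_self_of_le_mul {K f ℓ : ℝ} (hf : 0 ≤ f) (hℓ : 0 < ℓ) (hfK : f ≤ K * ℓ) :
    f ≤ (K + 1) * √(f * ℓ) := by
  have hK : 0 ≤ K := nonneg_of_mul_nonneg_left (hf.trans hfK) hℓ
  have hXsq : √(f * ℓ) ^ 2 = f * ℓ := Real.sq_sqrt (by positivity)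
  refine le_of_sq_le_sq ?_ (by positivity)
  nlinarith [mul_le_mul_of_nonneg_left hfK hf, mul_nonneg hK (sq_nonneg √(f * ℓ)),
    sq_nonneg (K * √(f * ℓ)), sq_nonneg √(f * ℓ)]

/-! ### Removing a real zero -/

open Complex Metric in
/-- Dividing out a real zero in `[1 / 2, 1]` costs only a constant in the growth bound. -/
theorem Complex.norm_dslope_le {g : ℂ → ℂ} {β B : ℝ} (hβ : g β = 0) (h1 : 1 / 2 ≤ β) (h2 : β ≤ 1)
    (hB0 : 0 ≤ B) (hB : ∀ s ∈ sphere (9 / 8 : ℂ) 1, ‖g s‖ ≤ B * ‖g (9 / 8)‖) {s : ℂ}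
    (hs : s ∈ sphere (9 / 8 : ℂ) 1) :
    ‖dslope g β s‖ ≤ 5 / 3 * B * ‖dslope g β (9 / 8)‖ := by
  have e : ∀ w : ℂ, ‖w - β‖ * ‖dslope g β w‖ = ‖g w‖ := fun w ↦ by
    rw [← norm_mul, ← smul_eq_mul, sub_smul_dslope, hβ, sub_zero]
  have hc : ‖(9 / 8 : ℂ) - β‖ = 9 / 8 - β := by
    have : (9 / 8 : ℂ) - β = ((9 / 8 - β : ℝ) : ℂ) := by push_cast; ring
    rw [this, norm_real, Real.norm_of_nonneg (by linarith)]
  have hs' : 3 / 8 ≤ ‖s - β‖ := by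
    have h3 : ‖s - 9 / 8‖ = 1 := by rwa [mem_sphere, dist_eq_norm] at hs
    have h4 : ‖s - β‖ ≥ ‖s - 9 / 8‖ - ‖(9 / 8 : ℂ) - β‖ := by
      have := norm_sub_le (s - β) (9 / 8 - β)
      rw [sub_sub_sub_cancel_right] at this
      linarith
    rw [h3, hc] at h4
    linarith
  refine le_of_mul_le_mul_left ?_ (by norm_num : (0 : ℝ) < 3 / 8)
  -- `β` is within `5/8` of the centre and at least `3/8` from the circle, hence the factor `5/3`.
  calc 3 / 8 * ‖dslope g β s‖ ≤ ‖s - β‖ * ‖dslope g β s‖ := by gcongr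
    _ ≤ B * ‖g (9 / 8)‖ := by rw [e]; exact hB s hs
    _ = B * ((9 / 8 - β) * ‖dslope g β (9 / 8)‖) := by rw [← e, hc]
    _ ≤ B * (5 / 8 * ‖dslope g β (9 / 8)‖) := by gcongr; linarith
    _ = _ := by ring

/-- The logarithmic derivative after dividing out a simple zero. -/
theorem Complex.logDeriv_eq_inv_add_logDeriv_dslope {g : ℂ → ℂ} (hg : Differentiable ℂ g) {β s : ℂ}
    (hβ : g β = 0) (hs : g s ≠ 0) :
    logDeriv g s = (s - β)⁻¹ + logDeriv (dslope g β) s := by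
  have hd : Differentiable ℂ (dslope g β) := differentiableOn_univ.mp
    ((differentiableOn_dslope Filter.univ_mem).mpr hg.differentiableOn)
  have e : ∀ w, (w - β) * dslope g β w = g w := fun w ↦ by
    rw [← smul_eq_mul, sub_smul_dslope, hβ, sub_zero]
  have hne := e s ▸ hs
  have := logDeriv_mul (f := fun w ↦ w - β) s (left_ne_zero_of_mul hne)
    (right_ne_zero_of_mul hne) (by fun_prop) (hd s)
  rw [funext e] at this
  rw [this]
  congr 1
  simp [logDeriv_apply]

/-! ### Real zeros and growth of `L(s, χ)` -/

/-- The real zeros of a nontrivial Dirichlet `L`-function have a maximum, which is less than `1`. -/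
theorem DirichletCharacter.exists_isGreatest_real_zero {q : ℕ} [NeZero q]
    {χ : DirichletCharacter ℂ q} (hχ : χ ≠ 1) :
    ∃ β : ℝ, β < 1 ∧ IsGreatest {x : ℝ | χ.LFunction (x : ℂ) = 0} β := by
  set S := {x : ℝ | χ.LFunction (x : ℂ) = 0}
  have hcl : IsClosed S := isClosed_eq
    ((differentiable_LFunction hχ).continuous.comp Complex.continuous_ofReal) continuous_const
  have hlt : ∀ x ∈ S, x < 1 := fun x hx ↦ by
    by_contra! h
    exact LFunction_ne_zero_of_one_le_re χ (.inl hχ) (by simpa using h) hx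
  have hbdd : BddAbove S := ⟨1, fun x hx ↦ (hlt x hx).le⟩
  -- The trivial zeros at `-2` (even) and `-1` (odd).
  have hne : S.Nonempty := by
    rcases χ.even_or_odd with he | ho
    · refine ⟨-(2 * (0 + 1)), ?_⟩
      simpa [S] using he.LFunction_neg_two_mul_nat_add_one 0
    · refine ⟨-1, ?_⟩
      simpa [S] using ho.LFunction_neg_two_mul_nat_sub_one 0
  have hmem := hcl.csSup_mem hne hbdd
  exact ⟨sSup S, hlt _ hmem, hmem, fun x hx ↦ le_csSup hbdd hx⟩

open Complex Metric in
/-- Growth of nontrivial Dirichlet `L`-functions relative to the value at `9 / 8`. -/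
theorem DirichletCharacter.exists_norm_LFunction_le_mul :
    ∃ M₁ : ℝ, 0 < M₁ ∧ ∀ (q : ℕ) [NeZero q] (χ : DirichletCharacter ℂ q), χ ≠ 1 →
      8 ≤ Real.log q → ∃ B : ℝ, 0 ≤ B ∧ B ≤ Real.exp (M₁ * Real.log q) ∧
        5 / 3 * B ≤ Real.exp (M₁ * Real.log q) ∧
        ∀ s ∈ sphere (9 / 8 : ℂ) 1, ‖χ.LFunction s‖ ≤ B * ‖χ.LFunction (9 / 8)‖ := by
  obtain ⟨c, hc, hL⟩ := exists_le_norm_LFunction (s := 9 / 8) (by norm_num)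
  -- On the circle `‖s‖ ≤ 17/8` and `Re s ≥ 1/8`, giving `17 q`; `29 > 5/3 * 17` leaves room for
  -- `norm_dslope_le`.
  refine ⟨1 + 29 / c, by positivity, fun q _ χ hχ hq ↦ ⟨17 * q / c, by positivity, ?_⟩⟩
  have hq0 : (0 : ℝ) < q := mod_cast NeZero.pos q
  have h1 : 29 / c * q ≤ Real.exp ((1 + 29 / c) * Real.log q) := by
    rw [add_mul, one_mul, Real.exp_add, Real.exp_log hq0, mul_comm]
    gcongr
    refine le_trans ?_ (Real.add_one_le_exp _)
    nlinarith [show 0 < 29 / c by positivity]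
  have h2 : 5 / 3 * (17 * q / c) ≤ 29 / c * q := by
    have : 0 ≤ q / c := by positivity
    calc 5 / 3 * (17 * q / c) = 85 / 3 * (q / c) := by ring
      _ ≤ 29 * (q / c) := by gcongr; norm_num
      _ = _ := by ring
  have h0 : 0 ≤ 17 * q / c := by positivity
  refine ⟨by linarith, by linarith, fun s hs ↦ ?_⟩
  have hs' : ‖s - 9 / 8‖ = 1 := by rwa [mem_sphere, dist_eq_norm] at hs
  have hre : 1 / 8 ≤ s.re := by
    have := neg_le_of_abs_le ((abs_re_le_norm (s - 9 / 8)).trans hs'.le)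
    simp at this
    norm_num at this
    linarith
  have hn : ‖s‖ ≤ 17 / 8 := by
    calc ‖s‖ = ‖(s - 9 / 8) + 9 / 8‖ := by rw [sub_add_cancel]
      _ ≤ 1 + 9 / 8 := by
        refine (norm_add_le _ _).trans ?_
        rw [hs']
        norm_num
      _ = _ := by norm_num
  calc ‖χ.LFunction s‖ ≤ ‖s‖ * (q / s.re) := norm_LFunction_le hχ (by linarith)
    _ ≤ 17 / 8 * (q / (1 / 8)) := by gcongr
    _ = 17 * q / c * c := by field_simp
    _ ≤ _ := by gcongr; exact hL q χ

/-! ### Assembly -/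

/-- The disc has height `2/5` while the box has height at least `3/4`, so only the real part
matters. -/
theorem mem_boxRegion_of_mem_closedBall {f : ℕ → ℝ} {q : ℕ} (hf : 2 ≤ f q) (hq : 8 ≤ Real.log q)
    {s : ℂ} (hs : s ∈ Metric.closedBall (9 / 8 : ℂ) (2 / 5)) (hre : 1 - 1 / f q < s.re) :
    s ∈ boxRegion f q := by
  refine ⟨hre, ?_⟩
  have h1 : |s.im| ≤ 2 / 5 := by
    rw [Metric.mem_closedBall, dist_eq_norm] at hs
    refine le_trans (le_of_eq ?_) ((Complex.abs_im_le_norm _).trans hs)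
    simp
  have h2 : 4 ≤ √(f q * Real.log q) := Real.le_sqrt_of_sq_le (by nlinarith)
  have h3 := one_div_le_one_div_of_le (by norm_num) h2
  linarith

theorem AnalyticAt.deriv_ne_zero_of_analyticOrderAt_eq_one {g : ℂ → ℂ} {z : ℂ}
    (hg : AnalyticAt ℂ g z) (h : analyticOrderAt g z = 1) : deriv g z ≠ 0 := by
  rw [← hg.deriv.analyticOrderAt_eq_zero]
  exact analyticOrderAt_deriv_of_pos hg (n := 0) (by simpa using h)

open Complex Metric DirichletCharacter in
theorem mainTheorem1 (K : ℝ) :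
    ∃ (C : ℝ) (q₀ : ℕ), ∀ f : ℕ → ℝ,
      (∀ q : ℕ, 2 ≤ q → 2 ≤ f q ∧ f q ≤ K * Real.log q) →
      IsQuasiZeroFree (boxRegion f) →
      ∀ (q : ℕ) [NeZero q], 2 ≤ q → q₀ ≤ q →
        ∀ χ : DirichletCharacter ℂ q, χ.IsPrimitive →
          (¬ IsRealCharacter χ →
            |(deriv χ.LFunction 1 / χ.LFunction 1).re| ≤ C * √(f q * Real.log q)) ∧
          (IsRealCharacter χ →
            ∃ β : ℝ, IsGreatest {x : ℝ | χ.LFunction (x : ℂ) = 0} β ∧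
              ‖deriv χ.LFunction 1 / χ.LFunction 1 - 1 / (1 - (β : ℂ))‖
                ≤ C * √(f q * Real.log q)) := by
  obtain ⟨M₁, hM₁, hgrowth⟩ := exists_norm_LFunction_le_mul
  obtain ⟨A, hA, hzeta⟩ := exists_norm_logDeriv_riemannZeta_le
  obtain ⟨C, hC⟩ := norm_logDeriv_one_le_mul_sqrt (K := K) hM₁ hA
  -- `|K + 1|` pays for `1 / (1 - β)` when `β` is outside the region; `log q ≥ 8` and `f ≥ 2` give
  -- `X ≥ 4`.
  refine ⟨C + |K + 1|, ⌈Real.exp 8⌉₊, fun f hf hzf q _ hq hq₀ χ hprim ↦ ?_⟩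
  obtain ⟨hf2, hfK⟩ := hf q hq
  have hℓ : 8 ≤ Real.log q :=
    (Real.le_log_iff_exp_le (by positivity)).mpr ((Nat.le_ceil _).trans (by exact_mod_cast hq₀))
  have hχ : χ ≠ 1 := by
    rintro rfl
    have := (DirichletCharacter.isPrimitive_def _).mp hprim
    rw [DirichletCharacter.conductor_one] at this
    omega
  obtain ⟨B, hB0, hB1, hB2, hB⟩ := hgrowth q χ hχ hℓ
  have hL := differentiable_LFunction hχ
  set X := √(f q * Real.log q)
  have hX4 : 4 ≤ X := Real.le_sqrt_of_sq_le (by nlinarith)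
  have hfX : f q ≤ |K + 1| * X :=
    (le_mul_sqrt_mul_self_of_le_mul (by linarith) (by linarith) hfK).trans
      (by gcongr; exact le_abs_self _)
  have hX1 : 1 / X ≤ 1 := by
    rw [div_le_one (by linarith)]
    linarith
  have hX0 : 0 < 1 / X := by positivity
  have hlog : ‖logDeriv χ.LFunction (1 + (1 / X : ℝ))‖ ≤ X + A := by
    have h1 := norm_logDeriv_LFunction_le χ (x := 1 + 1 / X) (by linarith)
    have h2 := hzeta (1 / X) hX0 hX1
    rw [one_div_one_div] at h2
    rw [ofReal_add, ofReal_one] at h1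
    exact h1.trans h2
  have hfree : (∀ s ∈ boxRegion f q, χ.LFunction s ≠ 0) → ‖logDeriv χ.LFunction 1‖ ≤ C * X := by
    intro h
    refine hC (f q) _ _ hf2 hfK hℓ hL (fun s hs ↦ (hB s hs).trans (by gcongr)) (fun ρ hρ hρ0 ↦ ?_)
      (hlog.trans (by linarith))
    by_contra! hre
    exact h ρ (mem_boxRegion_of_mem_closedBall hf2 hℓ hρ hre) hρ0
  obtain ⟨hcomplex, hreal⟩ := hzf q hq χ hprim
  refine ⟨fun hnr ↦ ?_, fun hr ↦ ?_⟩
  · calc |(deriv χ.LFunction 1 / χ.LFunction 1).re| ≤ ‖logDeriv χ.LFunction 1‖ := abs_re_le_norm _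
      _ ≤ C * X := hfree (hcomplex hnr)
      _ ≤ _ := by gcongr; linarith [abs_nonneg (K + 1)]
  · obtain ⟨hsub, hsimple⟩ := hreal hr
    obtain ⟨β, hβ1, hβ⟩ := exists_isGreatest_real_zero hχ
    refine ⟨β, hβ, ?_⟩
    rw [← logDeriv_apply]
    rcases le_or_gt β (1 - 1 / f q) with hle | hgt
    · have h1 : ‖1 / (1 - (β : ℂ))‖ ≤ f q := by
        have e : 1 / (1 - (β : ℂ)) = ((1 / (1 - β) : ℝ) : ℂ) := by push_cast; rfl
        rw [e, norm_real, Real.norm_of_nonneg (by rw [one_div_nonneg]; linarith),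
          div_le_comm₀ (by linarith) (by linarith)]
        linarith
      -- A zero in the region would be real and exceed the largest real zero.
      have h2 := hfree fun s hs h0 ↦ by
        have hs' : ((s.re : ℝ) : ℂ) = s := Complex.ext rfl (hsimple s hs h0).1.symm
        have := hβ.2 (show χ.LFunction (s.re : ℂ) = 0 by rw [hs', h0])
        linarith [hs.1]
      calc _ ≤ C * X + f q := (norm_sub_le _ _).trans (add_le_add h2 h1)
        _ ≤ C * X + |K + 1| * X := by gcongr
        _ = _ := by ring
    · have hβ0 : χ.LFunction β = 0 := hβ.1
      have hinv : 1 / f q ≤ 1 / 2 := one_div_le_one_div_of_le (by norm_num) hf2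
      have hβmem : (β : ℂ) ∈ boxRegion f q := by
        refine ⟨hgt, ?_⟩
        have := one_div_le_one_div_of_le (by norm_num) hX4
        rw [ofReal_im, abs_zero]
        linarith
      have hL1 : ∀ s : ℂ, 1 ≤ s.re → χ.LFunction s ≠ 0 := fun s hs ↦
        LFunction_ne_zero_of_one_le_re χ (.inl hχ) hs
      have hd : Differentiable ℂ (dslope χ.LFunction β) := differentiableOn_univ.mp
        ((differentiableOn_dslope Filter.univ_mem).mpr hL.differentiableOn)
      have h1 := logDeriv_eq_inv_add_logDeriv_dslope hL hβ0 (hL1 1 (by simp))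
      have h2 := logDeriv_eq_inv_add_logDeriv_dslope hL hβ0 (s := 1 + (1 / X : ℝ))
        (hL1 _ (by rw [add_re, one_re, ofReal_re]; linarith))
      have hinvX : ‖(1 + (1 / X : ℝ) - β : ℂ)⁻¹‖ ≤ X := by
        have e : (1 + (1 / X : ℝ) - β : ℂ)⁻¹ = (((1 + 1 / X - β)⁻¹ : ℝ) : ℂ) := by push_cast; rfl
        rw [e, norm_real, Real.norm_of_nonneg (by rw [inv_nonneg]; linarith)]
        refine inv_le_of_inv_le₀ (by linarith) ?_
        rw [← one_div]
        linarith
      have hkey : ‖logDeriv (dslope χ.LFunction β) 1‖ ≤ C * X := by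
        refine hC (f q) _ _ hf2 hfK hℓ hd (fun s hs ↦ ?_) (fun ρ hρ hρ0 ↦ ?_) ?_
        · refine (norm_dslope_le hβ0 (by linarith) hβ1.le hB0 hB hs).trans ?_
          gcongr
        · by_contra! hre
          have hρ1 : χ.LFunction ρ = 0 := by
            have := sub_smul_dslope χ.LFunction β ρ
            rwa [hρ0, smul_zero, hβ0, sub_zero, eq_comm] at this
          have hmem := mem_boxRegion_of_mem_closedBall hf2 hℓ hρ hre
          -- The only candidate is `β` itself, where `dslope` is `L'(β)`, nonzero by simplicity.
          obtain rfl := hsub ⟨hmem, hρ1⟩ ⟨hβmem, hβ0⟩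
          rw [dslope_same] at hρ0
          exact (hL.analyticAt _).deriv_ne_zero_of_analyticOrderAt_eq_one
            (hsimple _ hβmem hβ0).2.2 hρ0
        -- Removing `β` costs at most `X` more at `1 + 1/X`, whence the `2` in the hypothesis of
        -- `norm_logDeriv_one_le_mul_sqrt`.
        · rw [eq_sub_of_add_eq' h2.symm]
          refine (norm_sub_le _ _).trans ((add_le_add hlog hinvX).trans ?_)
          linarith
      rw [h1, one_div, add_sub_cancel_left]
      refine hkey.trans ?_
      gcongr
      linarith [abs_nonneg (K + 1)]
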